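/- **Conventions.** A time scale $\mathbb T$ is a nonempty closed subset of $\mathbb R$. For $t\in\mathbb T$ put $\sigma(t)=\inf\{s\in\mathbb T:s>t\}$, $\rho(t)=\sup\{s\in\mathbb T:s<t\}$ (with $\sigma(\max\mathbb T)=\max\mathbb T$, $\rho(\min\mathbb T)=\min\mathbb T$ when these exist), $\mu(t)=\sigma(t)-t$ and $f^\sigma=f\circ\sigma$. The point $t$ is right-dense if $\sigma(t)=t$, left-dense if $\rho(t)=t$, and left-scattered if $\rho(t)<t$. The set $\mathbb T^\kappa$ is $\mathbb T$ without its maximum if $\mathbb T$ has a left-scattered maximum, and $\mathbb T^\kappa=\mathbb T$ otherwise; $\mathbb T^{\kappa^2}=(\mathbb T^\kappa)^\kappa$. For $t\in\mathbb T^\kappa$, $$f^\Delta(t)=\lim_{s\to t,\ s\in\mathbb T\setminus\{\sigma(t)\}}\frac{f(\sigma(t))-f(s)}{\sigma(t)-s};$$ $y^{\Delta\Delta}$ is the delta derivative, on the time scale $\mathbb T^\kappa$ and at the points of $\mathbb T^{\kappa^2}$, of $y^\Delta:\mathbb T^\kappa\to\mathbb R$. (If $\mathbb T$ or $\mathbb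 T^\kappa$ is a single point, the limit is over an empty set of $s$ and any number counts as a derivative there.) A function is rd-continuous on a time scale if it is continuous at right-dense points and has finite left limits at left-dense points. The symbol $\int f(t)\,\Delta t$ denotes any antiderivative, i.e. any $F$ with $F^\Delta=f$ on $\mathbb T^\kappa$, and $\int_a^tf(\tau)\,\Delta\tau=F(t)-F(a)$. If $f$ is rd-continuous with $1+\mu f\ne0$ on $\mathbb T^\kappa$, then $$e_f(t,a)=\exp\Big(\int_a^t\xi_f(\tau)\,\Delta\tau\Big),\qquad \xi_f(\tau)=\begin{cases}f(\tau),&\mu(\tau)=0,\\ \frac1{\mu(\tau)}\operatorname{Log}\big(1+\mu(\tau)f(\tau)\big),&\mu(\tau)\neq0,\end{cases}$$ with the principal complex logarithm $\operatorname{Log}$, and $e_{\ominus f}=1/e_f$. **Theorem.** Let $\mathbb T$ be a time scale, $a\in\mathbb T$, and let $p,q,r$ be real-valued and rd-continuous on $\mathbb T$, with $$1+\mu(t)\,[-p(t)+\mu(t)q(t)]\neq0,\qquad t\in\mathbb T^\kappa.$$ Assume also that $r$ is rd-continuous on the time scale $\mathbb T^\kappa$ (this adds something only if $\mathbb T$ has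 a left-scattered maximum $M$ for which $\rho(M)$ is left-dense; it then says that $r$ is left-continuous at $\rho(M)$). Let $y_1,y_2$ be solutions of $$y^{\Delta\Delta}(t)+p(t)y^\Delta(t)+q(t)y(t)=0,\qquad t\in\mathbb T^{\kappa^2},$$ with $W(t)=y_1(t)y_2^\Delta(t)-y_2(t)y_1^\Delta(t)\neq0$ for all $t\in\mathbb T^\kappa$. Let $i\in\{1,2\}$ be such that $y_i(t)\neq0$ for all $t\in\mathbb T$. Then the iterated indefinite integral $$V(t)=\int\frac{e_{(-p+\mu q)}(t,a)\int r(t)\,y_i^\sigma(t)\,e_{\ominus(-p+\mu q)}(\sigma(t),a)\,\Delta t}{y_i(t)\,y_i^\sigma(t)}\,\Delta t$$ exists, i.e. both antiderivatives can be found; and for every choice of the two antiderivatives the general solution of $$y^{\Delta\Delta}(t)+p(t)y^\Delta(t)+q(t)y(t)=r(t),\qquad t\in\mathbb T^{\kappa^2},$$ is $$y(t)=c_1y_1(t)+c_2y_2(t)+y_i(t)V(t),\qquad t\in\mathbb T,$$ with $c_1,c_2$ arbitrary real constants: all these functions are solutions, and every solution is of this form. -/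

import Mathlib

open Set Filter Topology

noncomputable section

namespace TimeScale

/-- A time scale: a nonempty closed subset of the real line. -/
def IsTimeScale (T : Set ℝ) : Prop := T.Nonempty ∧ IsClosed T

open Classical in
/-- Forward jump operator `σ(t) = inf {s ∈ T : s > t}`. If `t` is the maximum of `T` then
`σ(t) = t`, which is the usual convention `inf ∅ = sup T`. -/
def sigma (T : Set ℝ) (t : ℝ) : ℝ :=
  if (T ∩ Ioi t).Nonempty then sInf (T ∩ Ioi t) else t

open Classical in
/-- Backward jump operator `ρ(t) = sup {s ∈ T : s < t}`. If `t` is the minimum of `T` then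
`ρ(t) = t`, which is the usual convention `sup ∅ = inf T`. -/
def rho (T : Set ℝ) (t : ℝ) : ℝ :=
  if (T ∩ Iio t).Nonempty then sSup (T ∩ Iio t) else t

/-- Graininess `μ(t) = σ(t) - t`. -/
def mu (T : Set ℝ) (t : ℝ) : ℝ := sigma T t - t

/-- `T^κ`: the time scale `T` without its maximum if that maximum is left-scattered,
and `T` itself otherwise. -/
def kappa (T : Set ℝ) : Set ℝ := {t ∈ T | ¬ (IsGreatest T t ∧ rho T t < t)}

/-- `f^Δ(t) = f'`, that is, `(f(σ(t)) - f(s)) / (σ(t) - s) → f'` as `s → t`, where `s` ranges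
over the points of `T` other than `σ(t)`. (So `s = t` is allowed at right-scattered `t`.) -/
def HasDeltaDerivAt {E : Type*} [NormedAddCommGroup E] [NormedSpace ℝ E]
    (T : Set ℝ) (f : ℝ → E) (f' : E) (t : ℝ) : Prop :=
  Tendsto (fun s => (sigma T t - s)⁻¹ • (f (sigma T t) - f s)) (𝓝[T \ {sigma T t}] t) (𝓝 f')

/-- Right-dense continuity on `T`: continuity at the right-dense points (`σ(t) = t`) and existence
of finite left-sided limits at the left-dense points (`ρ(t) = t`), all within `T`. -/
def RdContinuousOn (T : Set ℝ) (f : ℝ → ℝ) : Prop :=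
  (∀ t ∈ T, sigma T t = t → ContinuousWithinAt f T t) ∧
  (∀ t ∈ T, rho T t = t → ∃ l : ℝ, Tendsto f (𝓝[T ∩ Iio t] t) (𝓝 l))

/-- `F` is a delta antiderivative of `f` on `T`, `F = ∫ f(t) Δt`: `F^Δ = f` on `T^κ`. -/
def IsDeltaAntideriv {E : Type*} [NormedAddCommGroup E] [NormedSpace ℝ E]
    (T : Set ℝ) (F f : ℝ → E) : Prop :=
  ∀ t ∈ kappa T, HasDeltaDerivAt T F (f t) t

open Classical in
/-- The Cauchy delta integral `∫_a^b f(τ) Δτ = F(b) - F(a)`, `F` a delta antiderivative of `f`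
(antiderivatives on a time scale are unique up to a constant); `0` if there is none. -/
def deltaIntegral {E : Type*} [NormedAddCommGroup E] [NormedSpace ℝ E]
    (T : Set ℝ) (f : ℝ → E) (a b : ℝ) : E :=
  if h : ∃ F : ℝ → E, IsDeltaAntideriv T F f then h.choose b - h.choose a else 0

/-- The regressivity condition `1 + μ(t) f(t) ≠ 0` for all `t ∈ T^κ`. -/
def Regressive (T : Set ℝ) (f : ℝ → ℝ) : Prop := ∀ t ∈ kappa T, 1 + mu T t * f t ≠ 0

open Classical in
/-- The integrand of the exponential function: `f(τ)` if `μ(τ) = 0`, and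
`Log(1 + μ(τ) f(τ)) / μ(τ)` if `μ(τ) ≠ 0`, with the principal complex logarithm. -/
def cylinder (T : Set ℝ) (f : ℝ → ℝ) (τ : ℝ) : ℂ :=
  if mu T τ = 0 then (f τ : ℂ)
  else (1 / (mu T τ : ℂ)) * Complex.log (1 + (mu T τ : ℂ) * (f τ : ℂ))

/-- The time-scale exponential function `e_f(t,a)`, the exponential of the delta integral of
`cylinder T f` from `a` to `t`. For regressive rd-continuous real `f` and `a, t ∈ T` that
exponential is a real number, and `re` only changes its type. -/
def deltaExp (T : Set ℝ) (f : ℝ → ℝ) (t a : ℝ) : ℝ :=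
  (Complex.exp (deltaIntegral T (cylinder T f) a t)).re

/-- `y`, with delta derivative `yΔ`, satisfies `y^{ΔΔ} + p y^Δ + q y = r` on `T^{κ²}`.
Here `y^Δ` is a function on the time scale `T^κ`, and `y^{ΔΔ}` is its delta derivative on that time
scale, at the points of `T^{κ²} = (T^κ)^κ`. -/
def IsSolutionWith (T : Set ℝ) (p q r y yΔ : ℝ → ℝ) : Prop :=
  (∀ t ∈ kappa T, HasDeltaDerivAt T y (yΔ t) t) ∧
  ∃ yΔΔ : ℝ → ℝ, (∀ t ∈ kappa (kappa T), HasDeltaDerivAt (kappa T) yΔ (yΔΔ t) t) ∧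
    ∀ t ∈ kappa (kappa T), yΔΔ t + p t * yΔ t + q t * y t = r t

/-- `y` is a solution of `y^{ΔΔ} + p y^Δ + q y = r` on `T^{κ²}`. -/
def IsSolution (T : Set ℝ) (p q r y : ℝ → ℝ) : Prop :=
  ∃ yΔ : ℝ → ℝ, IsSolutionWith T p q r y yΔ

/-- The coefficient `-p + μ q`. -/
def coeff (T : Set ℝ) (p q : ℝ → ℝ) (t : ℝ) : ℝ := -p t + mu T t * q t

/-- The inner integrand `r(t) z(σ(t)) e_{⊖(-p+μq)}(σ(t),a)`, where `e_{⊖f} = 1 / e_f`. -/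
def innerIntegrand (T : Set ℝ) (p q r z : ℝ → ℝ) (a t : ℝ) : ℝ :=
  r t * z (sigma T t) * (1 / deltaExp T (coeff T p q) (sigma T t) a)

/-- The outer integrand `e_{-p+μq}(t,a) F(t) / (z(t) z(σ(t)))`. -/
def outerIntegrand (T : Set ℝ) (p q z F : ℝ → ℝ) (a t : ℝ) : ℝ :=
  deltaExp T (coeff T p q) t a * F t / (z t * z (sigma T t))

/-- `V` is a value of the iterated indefinite integral
`∫ [e_{-p+μq}(t,a) ∫ r(t) z^σ(t) e_{⊖(-p+μq)}(σ(t),a) Δt] / (z(t) z^σ(t)) Δt`. -/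
def IsIteratedIntegral (T : Set ℝ) (p q r z : ℝ → ℝ) (a : ℝ) (V : ℝ → ℝ) : Prop :=
  ∃ F : ℝ → ℝ, IsDeltaAntideriv T F (innerIntegrand T p q r z a) ∧
    IsDeltaAntideriv T V (outerIntegrand T p q z F a)

end TimeScale

end

/-!
Two solutions of the homogeneous equation have a Wronskian `W` with `W^Δ = (-p + μ q) W`. Hence
`W` is a nonzero constant multiple of `E = e_{-p+μq}(·, a)`, so that `E` has no zeros, and the
quotient of any two Wronskians of homogeneous solutions is constant. By Cramer's rule these
constant quotients are the coefficients expressing a homogeneous solution through `y₁` and `y₂`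
(`exists_eq_linear_combination`); no uniqueness theorem for initial value problems is needed. The
equation with right-hand side `r` is treated by reduction of order. If `F` and `V` are the inner and
the outer antiderivative for a zero-free solution `z`, then `z V` has the delta derivative
`z^Δ V + E F / z`, and differentiating once more shows that it is a particular solution
(`isSolutionWith_mul_of_isDeltaAntideriv`).

Two points need care. First, antiderivatives, including the complex one in the definition of the
exponential function, have to exist: for a right-dense continuous `f`, extend `f` to be constant
across the gaps of `T` and take a Lebesgue integral (`exists_isDeltaAntideriv_of_rd`). Second,
`y^{ΔΔ}` is a derivative on `kappa T`, whose forward jump differs from that of `T` at the maximum of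
`kappa T`. At that point a derivative on `kappa T` is a left derivative, which the mean value
inequality on time scales (`norm_sub_le_of_norm_deltaDeriv_le`) identifies with the left limit of
the derivative on `T`. Therefore `W`, `E`, `F`, `V` and `z` satisfy on `kappa T` the same equations
as on `T`, with the jump and the graininess of `kappa T`, and one computation covers all points.
-/

namespace TimeScale

variable {T : Set ℝ} {t s : ℝ}

/-! ### Jump operators and the truncated time scale -/

lemma le_sigma (T : Set ℝ) (t : ℝ) : t ≤ sigma T t := by
  unfold sigma
  split_ifs with h
  · exact le_csInf h fun s hs => hs.2.le
  · exact le_rfl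

lemma sigma_le (hs : s ∈ T) (hts : t < s) : sigma T t ≤ s := by
  have hs' : s ∈ T ∩ Ioi t := ⟨hs, hts⟩
  rw [sigma, if_pos ⟨s, hs'⟩]
  exact csInf_le ⟨t, fun x hx => hx.2.le⟩ hs'

lemma sigma_mem (hT : IsClosed T) (ht : t ∈ T) : sigma T t ∈ T := by
  unfold sigma
  split_ifs with h
  · have h1 : sInf (T ∩ Ioi t) ∈ closure (T ∩ Ioi t) :=
      csInf_mem_closure h ⟨t, fun x hx => hx.2.le⟩
    exact hT.closure_subset_iff.2 inter_subset_left h1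
  · exact ht

lemma sigma_eq_self_of_forall_le (h : ∀ s ∈ T, s ≤ t) : sigma T t = t := by
  rw [sigma, if_neg]
  rintro ⟨s, hs, hts⟩
  exact (not_lt.2 (h s hs)) hts

lemma exists_mem_Ioo_of_sigma_eq (h : sigma T t = t) (hs : s ∈ T) (hts : t < s) {b : ℝ}
    (hb : t < b) : ∃ u ∈ T, t < u ∧ u < b := by
  have hne : (T ∩ Ioi t).Nonempty := ⟨s, hs, hts⟩
  rw [sigma, if_pos hne] at h
  obtain ⟨u, hu, hub⟩ := exists_lt_of_csInf_lt hne (h.trans_lt hb)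
  exact ⟨u, hu.1, hu.2, hub⟩

lemma rho_le (T : Set ℝ) (t : ℝ) : rho T t ≤ t := by
  unfold rho
  split_ifs with h
  · exact csSup_le h fun s hs => hs.2.le
  · exact le_rfl

lemma le_rho (hs : s ∈ T) (hst : s < t) : s ≤ rho T t := by
  have hs' : s ∈ T ∩ Iio t := ⟨hs, hst⟩
  rw [rho, if_pos ⟨s, hs'⟩]
  exact le_csSup ⟨t, fun x hx => hx.2.le⟩ hs'

lemma rho_mem (hT : IsClosed T) (ht : t ∈ T) : rho T t ∈ T := by
  unfold rho
  split_ifs with h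
  · have h1 : sSup (T ∩ Iio t) ∈ closure (T ∩ Iio t) :=
      csSup_mem_closure h ⟨t, fun x hx => hx.2.le⟩
    exact hT.closure_subset_iff.2 inter_subset_left h1
  · exact ht

lemma kappa_subset (T : Set ℝ) : kappa T ⊆ T := fun _ h => h.1

lemma mem_kappa_of_lt (ht : t ∈ T) (hs : s ∈ T) (hts : t < s) : t ∈ kappa T :=
  ⟨ht, fun h => (not_lt.2 (h.1.2 hs)) hts⟩

lemma isClosed_kappa (hT : IsClosed T) : IsClosed (kappa T) := by
  by_cases h : ∃ M, IsGreatest T M ∧ rho T M < M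
  · obtain ⟨M, hM, hr⟩ := h
    have : kappa T = T ∩ Iic (rho T M) := by
      ext u
      constructor
      · rintro ⟨hu, hu'⟩
        refine ⟨hu, le_rho hu (lt_of_le_of_ne (hM.2 hu) ?_)⟩
        rintro rfl
        exact hu' ⟨hM, hr⟩
      · rintro ⟨hu, hu'⟩
        exact mem_kappa_of_lt hu hM.1 (lt_of_le_of_lt hu' hr)
    rw [this]
    exact hT.inter isClosed_Iic
  · have : kappa T = T := by
      ext u
      exact ⟨fun h => h.1, fun hu => ⟨hu, fun hc => h ⟨u, hc⟩⟩⟩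
    rwa [this]

/-- The only point that `T` can have outside `kappa T` is the successor of a point of `kappa T`. -/
lemma exists_sigma_eq_of_notMem_kappa (hT : IsClosed T) (ht : t ∈ T) (h : t ∉ kappa T) :
    ∃ m ∈ kappa T, m < t ∧ sigma T m = t := by
  have h' : IsGreatest T t ∧ rho T t < t := by
    by_contra hc
    exact h ⟨ht, hc⟩
  refine ⟨rho T t, mem_kappa_of_lt (rho_mem hT ht) ht h'.2, h'.2, ?_⟩
  refine le_antisymm (sigma_le ht h'.2) (le_of_not_gt fun hlt => ?_)
  have h1 := le_rho (sigma_mem hT (rho_mem hT ht)) hlt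
  have h2 : sigma T (rho T t) = rho T t := le_antisymm h1 (le_sigma _ _)
  obtain ⟨u, hu, hu1, hu2⟩ := exists_mem_Ioo_of_sigma_eq h2 ht h'.2 h'.2
  exact absurd (le_rho hu hu2) (not_le.2 hu1)

lemma kappa_nonempty (hT : IsTimeScale T) : (kappa T).Nonempty := by
  obtain ⟨t, ht⟩ := hT.1
  by_cases h : t ∈ kappa T
  · exact ⟨t, h⟩
  · obtain ⟨m, hm, -⟩ := exists_sigma_eq_of_notMem_kappa hT.2 ht h
    exact ⟨m, hm⟩

lemma isTimeScale_kappa (hT : IsTimeScale T) : IsTimeScale (kappa T) :=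
  ⟨kappa_nonempty hT, isClosed_kappa hT.2⟩

lemma sigma_kappa_of_lt (hs : s ∈ kappa T) (hts : t < s) : sigma (kappa T) t = sigma T t := by
  have hsT := kappa_subset T hs
  refine le_antisymm ?_ ?_
  · rw [sigma.eq_def T, if_pos ⟨s, hsT, hts⟩]
    refine le_csInf ⟨s, hsT, hts⟩ fun u hu => ?_
    by_cases hus : u < s
    · exact sigma_le (mem_kappa_of_lt hu.1 hsT hus) hu.2
    · exact (sigma_le hs hts).trans (not_lt.1 hus)
  · rw [sigma.eq_def (kappa T), if_pos ⟨s, hs, hts⟩]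
    exact le_csInf ⟨s, hs, hts⟩ fun u hu => sigma_le (kappa_subset T hu.1) hu.2

/-- Passing from `T` to `kappa T` changes the forward jump at the maximum of `kappa T` only. -/
lemma sigma_kappa_or (T : Set ℝ) (t : ℝ) : sigma (kappa T) t = sigma T t ∨
    (sigma (kappa T) t = t ∧ ∀ s ∈ kappa T, s ≤ t) := by
  by_cases h : ∃ s ∈ kappa T, t < s
  · obtain ⟨s, hs, hts⟩ := h
    exact Or.inl (sigma_kappa_of_lt hs hts)
  · push Not at h
    exact Or.inr ⟨sigma_eq_self_of_forall_le h, h⟩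

lemma inter_Iio_subset_kappa (ht : t ∈ T) : T ∩ Iio t ⊆ kappa T :=
  fun _ hs => mem_kappa_of_lt hs.1 ht hs.2

lemma add_mu (T : Set ℝ) (t : ℝ) : t + mu T t = sigma T t := by
  unfold mu; ring

/-- The forward jump is continuous from within `T` at right-dense points. -/
lemma tendsto_sigma_of_sigma_eq (ht : t ∈ T) (h : sigma T t = t) :
    Tendsto (sigma T) (𝓝[T] t) (𝓝 t) := by
  rw [tendsto_order]
  constructor
  · intro b hb
    filter_upwards [mem_nhdsWithin_of_mem_nhds (Ioi_mem_nhds hb)] with s hs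
    exact lt_of_lt_of_le hs (le_sigma T s)
  · intro b hb
    by_cases hne : ∃ s ∈ T, t < s
    · obtain ⟨s, hs, hts⟩ := hne
      obtain ⟨u, hu, htu, hub⟩ := exists_mem_Ioo_of_sigma_eq h hs hts hb
      filter_upwards [mem_nhdsWithin_of_mem_nhds (Iio_mem_nhds htu)] with x hx
      exact (sigma_le hu hx).trans_lt hub
    · push Not at hne
      filter_upwards [self_mem_nhdsWithin] with x hx
      rcases (hne x hx).lt_or_eq with hxt | hxt
      · exact (sigma_le ht hxt).trans_lt hb
      · rw [hxt, h]; exact hb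

/-- To the left of a point of `T` the forward jump tends to that point. -/
lemma tendsto_sigma_left (ht : t ∈ T) : Tendsto (sigma T) (𝓝[T ∩ Iio t] t) (𝓝 t) := by
  refine tendsto_of_tendsto_of_tendsto_of_le_of_le' (g := fun s : ℝ => s) (h := fun _ => t) ?_
    tendsto_const_nhds (Eventually.of_forall (le_sigma T)) ?_
  · exact tendsto_id.mono_left nhdsWithin_le_nhds
  · filter_upwards [self_mem_nhdsWithin] with s hs
    exact sigma_le ht hs.2

lemma tendsto_comp_sigma_of_sigma_eq {E : Type*} [TopologicalSpace E] {g : ℝ → E}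
    (hT : IsClosed T) (hg : ContinuousOn g T) (ht : t ∈ T) (h : sigma T t = t) :
    Tendsto (fun s => g (sigma T s)) (𝓝[T] t) (𝓝 (g t)) := by
  refine Tendsto.comp (hg t ht) (tendsto_nhdsWithin_iff.2 ⟨tendsto_sigma_of_sigma_eq ht h, ?_⟩)
  filter_upwards [self_mem_nhdsWithin] with s hs using sigma_mem hT hs

lemma tendsto_comp_sigma_left {E : Type*} [TopologicalSpace E] {g : ℝ → E}
    (hT : IsClosed T) (hg : ContinuousOn g T) (ht : t ∈ T) :
    Tendsto (fun s => g (sigma T s)) (𝓝[T ∩ Iio t] t) (𝓝 (g t)) := by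
  refine Tendsto.comp (hg t ht) (tendsto_nhdsWithin_iff.2 ⟨tendsto_sigma_left ht, ?_⟩)
  filter_upwards [self_mem_nhdsWithin] with s hs using sigma_mem hT hs.1

/-! ### Right-dense continuity -/

lemma RdContinuousOn.of_continuousOn {f : ℝ → ℝ} (hf : ContinuousOn f T) : RdContinuousOn T f :=
  ⟨fun t ht _ => hf t ht, fun t ht _ => ⟨f t, (hf t ht).mono_left (nhdsWithin_mono _
    inter_subset_left)⟩⟩

lemma RdContinuousOn.comp_sigma {f : ℝ → ℝ} (hT : IsClosed T) (hf : ContinuousOn f T) :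
    RdContinuousOn T fun t => f (sigma T t) := by
  refine ⟨fun t ht h => ?_, fun t ht _ => ⟨f t, tendsto_comp_sigma_left hT hf ht⟩⟩
  have := tendsto_comp_sigma_of_sigma_eq hT hf ht h
  rw [ContinuousWithinAt, h]
  exact this

lemma RdContinuousOn.add {f g : ℝ → ℝ} (hf : RdContinuousOn T f) (hg : RdContinuousOn T g) :
    RdContinuousOn T fun t => f t + g t := by
  refine ⟨fun t ht h => (hf.1 t ht h).add (hg.1 t ht h), fun t ht h => ?_⟩
  obtain ⟨l, hl⟩ := hf.2 t ht h
  obtain ⟨k, hk⟩ := hg.2 t ht h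
  exact ⟨_, hl.add hk⟩

lemma RdContinuousOn.mul {f g : ℝ → ℝ} (hf : RdContinuousOn T f) (hg : RdContinuousOn T g) :
    RdContinuousOn T fun t => f t * g t := by
  refine ⟨fun t ht h => (hf.1 t ht h).mul (hg.1 t ht h), fun t ht h => ?_⟩
  obtain ⟨l, hl⟩ := hf.2 t ht h
  obtain ⟨k, hk⟩ := hg.2 t ht h
  exact ⟨_, hl.mul hk⟩

lemma RdContinuousOn.neg {f : ℝ → ℝ} (hf : RdContinuousOn T f) :
    RdContinuousOn T fun t => -f t := by
  refine ⟨fun t ht h => (hf.1 t ht h).neg, fun t ht h => ?_⟩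
  obtain ⟨l, hl⟩ := hf.2 t ht h
  exact ⟨_, hl.neg⟩

lemma rdContinuousOn_mu (hT : IsClosed T) : RdContinuousOn T (mu T) := by
  have h1 : RdContinuousOn T fun t => sigma T t :=
    RdContinuousOn.comp_sigma (f := fun t => t) hT continuousOn_id
  have h2 : RdContinuousOn T fun t => -t := RdContinuousOn.of_continuousOn continuousOn_neg
  exact h1.add h2

lemma rdContinuousOn_coeff (hT : IsClosed T) {p q : ℝ → ℝ} (hp : RdContinuousOn T p)
    (hq : RdContinuousOn T q) : RdContinuousOn T (coeff T p q) :=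
  hp.neg.add ((rdContinuousOn_mu hT).mul hq)

/-! ### Delta derivatives -/

section Deriv

variable {E : Type*} [NormedAddCommGroup E] [NormedSpace ℝ E] {f : ℝ → E} {f' : E}

lemma hasDeltaDerivAt_iff_of_sigma_eq (h : sigma T t = t) :
    HasDeltaDerivAt T f f' t ↔ HasDerivWithinAt f f' T t := by
  rw [hasDerivWithinAt_iff_tendsto_slope, HasDeltaDerivAt, h]
  refine tendsto_congr fun s => ?_
  rw [slope_def_module, ← neg_sub s t, ← neg_sub (f s) (f t), inv_neg, neg_smul_neg]

lemma nhdsWithin_diff_sigma (h : sigma T t ≠ t) : 𝓝[T \ {sigma T t}] t = 𝓝[T] t := by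
  have h1 : {sigma T t}ᶜ ∈ 𝓝 t := isOpen_compl_singleton.mem_nhds h.symm
  rw [sdiff_eq, inter_comm, nhdsWithin_inter_of_mem (mem_nhdsWithin_of_mem_nhds h1)]

lemma hasDeltaDerivAt_iff_of_sigma_ne (ht : t ∈ T) (h : sigma T t ≠ t) :
    HasDeltaDerivAt T f f' t ↔
      ContinuousWithinAt f T t ∧ f (sigma T t) = f t + mu T t • f' := by
  have hmu : mu T t ≠ 0 := sub_ne_zero.2 h
  have hid : Tendsto (fun s : ℝ => sigma T t - s) (𝓝[T] t) (𝓝 (mu T t)) :=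
    (tendsto_const_nhds.sub tendsto_id).mono_left nhdsWithin_le_nhds
  rw [HasDeltaDerivAt, nhdsWithin_diff_sigma h]
  constructor
  · intro hf
    have h1 : Tendsto (fun s => f (sigma T t) - f s) (𝓝[T] t) (𝓝 (mu T t • f')) := by
      refine (hid.smul hf).congr' ?_
      filter_upwards [hid.eventually_ne hmu] with s hs
      rw [smul_inv_smul₀ hs]
    have h2 : Tendsto f (𝓝[T] t) (𝓝 (f (sigma T t) - mu T t • f')) := by
      simpa using (tendsto_const_nhds (x := f (sigma T t))).sub h1
    have h3 : f (sigma T t) - mu T t • f' = f t :=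
      tendsto_nhds_unique (h2.mono_left (pure_le_nhdsWithin ht)) (tendsto_pure_nhds f t)
    refine ⟨?_, by rw [← h3]; abel⟩
    rwa [h3] at h2
  · rintro ⟨hc, he⟩
    have h1 := (hid.inv₀ hmu).smul ((tendsto_const_nhds (x := f (sigma T t))).sub hc.tendsto)
    have h2 : (mu T t)⁻¹ • (f (sigma T t) - f t) = f' := by
      rw [he, add_sub_cancel_left, inv_smul_smul₀ hmu]
    rwa [h2] at h1

lemma HasDeltaDerivAt.sigma_eq (hf : HasDeltaDerivAt T f f' t) (ht : t ∈ T) :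
    f (sigma T t) = f t + mu T t • f' := by
  by_cases h : sigma T t = t
  · simp [mu, h]
  · exact ((hasDeltaDerivAt_iff_of_sigma_ne ht h).1 hf).2

lemma HasDeltaDerivAt.continuousWithinAt (hf : HasDeltaDerivAt T f f' t) (ht : t ∈ T) :
    ContinuousWithinAt f T t := by
  by_cases h : sigma T t = t
  · exact ((hasDeltaDerivAt_iff_of_sigma_eq h).1 hf).continuousWithinAt
  · exact ((hasDeltaDerivAt_iff_of_sigma_ne ht h).1 hf).1

/-- To check a delta derivative, treat right-dense points with the derivative within `T` and
right-scattered points with the difference quotient. -/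
lemma HasDeltaDerivAt.of_cases (ht : t ∈ T)
    (h1 : sigma T t = t → HasDerivWithinAt f f' T t)
    (hc : sigma T t ≠ t → ContinuousWithinAt f T t)
    (h2 : sigma T t ≠ t → f (sigma T t) = f t + mu T t • f') : HasDeltaDerivAt T f f' t := by
  by_cases h : sigma T t = t
  · exact (hasDeltaDerivAt_iff_of_sigma_eq h).2 (h1 h)
  · exact (hasDeltaDerivAt_iff_of_sigma_ne ht h).2 ⟨hc h, h2 h⟩

lemma HasDeltaDerivAt.hasDerivWithinAt (hf : HasDeltaDerivAt T f f' t) (h : sigma T t = t) :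
    HasDerivWithinAt f f' T t := (hasDeltaDerivAt_iff_of_sigma_eq h).1 hf

lemma HasDeltaDerivAt.add {g : ℝ → E} {g' : E} (hf : HasDeltaDerivAt T f f' t)
    (hg : HasDeltaDerivAt T g g' t) : HasDeltaDerivAt T (fun s => f s + g s) (f' + g') t := by
  refine (Tendsto.add hf hg).congr fun s => ?_
  rw [← smul_add, sub_add_sub_comm]

lemma HasDeltaDerivAt.sub {g : ℝ → E} {g' : E} (hf : HasDeltaDerivAt T f f' t)
    (hg : HasDeltaDerivAt T g g' t) : HasDeltaDerivAt T (fun s => f s - g s) (f' - g') t := by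
  refine (Tendsto.sub hf hg).congr fun s => ?_
  rw [← smul_sub, sub_sub_sub_comm]

lemma HasDeltaDerivAt.const_mul {f : ℝ → ℝ} {f' : ℝ} (c : ℝ) (hf : HasDeltaDerivAt T f f' t) :
    HasDeltaDerivAt T (fun s => c * f s) (c * f') t := by
  refine (Tendsto.const_mul c hf).congr fun s => ?_
  simp only [smul_eq_mul]; ring

lemma HasDeltaDerivAt.congr_on {g : ℝ → E} (hf : HasDeltaDerivAt T f f' t) (hT : IsClosed T)
    (ht : t ∈ T) (h : EqOn g f T) : HasDeltaDerivAt T g f' t := by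
  refine Tendsto.congr' ?_ hf
  filter_upwards [self_mem_nhdsWithin] with s hs
  rw [h (sigma_mem hT ht), h hs.1]

lemma HasDeltaDerivAt.mono {K : Set ℝ} (hf : HasDeltaDerivAt T f f' t) (hK : K ⊆ T)
    (h : sigma K t = sigma T t) : HasDeltaDerivAt K f f' t := by
  unfold HasDeltaDerivAt at hf ⊢
  rw [h]
  exact hf.mono_left (nhdsWithin_mono _ (sdiff_subset_sdiff_left hK))

lemma HasDeltaDerivAt.mul {f g : ℝ → ℝ} {f' g' : ℝ} (ht : t ∈ T)
    (hf : HasDeltaDerivAt T f f' t) (hg : HasDeltaDerivAt T g g' t) :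
    HasDeltaDerivAt T (fun s => f s * g s) (f' * g t + f (sigma T t) * g') t := by
  refine .of_cases ht (fun h => ?_)
    (fun _ => (hf.continuousWithinAt ht).mul (hg.continuousWithinAt ht)) (fun _ => ?_)
  · rw [h]; exact (hf.hasDerivWithinAt h).mul (hg.hasDerivWithinAt h)
  · rw [hf.sigma_eq ht, hg.sigma_eq ht]; simp only [smul_eq_mul]; ring

lemma HasDeltaDerivAt.div {f g : ℝ → ℝ} {f' g' : ℝ} (ht : t ∈ T)
    (hf : HasDeltaDerivAt T f f' t) (hg : HasDeltaDerivAt T g g' t) (h0 : g t ≠ 0)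
    (h1 : g (sigma T t) ≠ 0) :
    HasDeltaDerivAt T (fun s => f s / g s) ((f' * g t - f t * g') / (g t * g (sigma T t))) t := by
  refine .of_cases ht (fun h => ?_)
    (fun _ => (hf.continuousWithinAt ht).div (hg.continuousWithinAt ht) h0) (fun _ => ?_)
  · rw [h, ← sq]; exact (hf.hasDerivWithinAt h).div (hg.hasDerivWithinAt h) h0
  · have h2 := hg.sigma_eq ht
    rw [hf.sigma_eq ht, smul_eq_mul, smul_eq_mul]
    rw [smul_eq_mul] at h2
    field_simp
    rw [h2]
    ring

/-- A function delta differentiable on `kappa T` is continuous on all of `T`, since a point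
outside `kappa T` is isolated. -/
lemma continuousOn_of_hasDeltaDerivAt (hT : IsClosed T) {g : ℝ → E}
    (hf : ∀ t ∈ kappa T, HasDeltaDerivAt T f (g t) t) : ContinuousOn f T := by
  intro t ht
  by_cases h : t ∈ kappa T
  · exact (hf t h).continuousWithinAt ht
  · obtain ⟨m, hm, hmt, hσ⟩ := exists_sigma_eq_of_notMem_kappa hT ht h
    have h' : IsGreatest T t := by
      by_contra hc
      exact h ⟨ht, fun h => hc h.1⟩
    refine continuousWithinAt_const.congr_of_eventuallyEq (f := fun _ => f t) ?_ rfl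
    filter_upwards [self_mem_nhdsWithin, mem_nhdsWithin_of_mem_nhds (Ioi_mem_nhds hmt)]
      with s hs hms
    rw [le_antisymm (h'.2 hs) (hσ ▸ sigma_le hs hms)]

/-! ### The mean value inequality -/

/-- Only delta derivatives at points to the left of `b` are used. -/
theorem norm_sub_le_of_norm_deltaDeriv_le (hT : IsClosed T) {g : ℝ → E} {a b C : ℝ}
    (hfc : ContinuousOn f T) (ha : a ∈ T) (hb : b ∈ T) (hab : a ≤ b)
    (hf : ∀ t ∈ T, a ≤ t → t < b → HasDeltaDerivAt T f (g t) t)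
    (hC : ∀ t ∈ T, a ≤ t → t < b → ‖g t‖ ≤ C) : ‖f b - f a‖ ≤ C * (b - a) := by
  suffices H : ∀ D, C < D → ‖f b - f a‖ ≤ D * (b - a) by
    have h1 : Tendsto (fun D : ℝ => D * (b - a)) (𝓝[>] C) (𝓝 (C * (b - a))) :=
      (tendsto_id.mul_const _).mono_left nhdsWithin_le_nhds
    refine ge_of_tendsto h1 ?_
    filter_upwards [self_mem_nhdsWithin] with D hD using H D hD
  intro D hD
  -- The supremum `c` of the points reached by the estimate is itself reached; it can be moved
  -- to the right, by a jump or by the definition of the derivative, as long as `c < b`.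
  let A : Set ℝ := {t | t ∈ T ∩ Icc a b ∧ ‖f t - f a‖ ≤ D * (t - a)}
  have hAc : IsClosed A := by
    have hTc : IsClosed (T ∩ Icc a b) := hT.inter isClosed_Icc
    have hfc' := hfc.mono (inter_subset_left (t := Icc a b))
    exact hTc.isClosed_le (hfc'.sub continuousOn_const).norm (by fun_prop)
  have haA : a ∈ A := ⟨⟨ha, le_rfl, hab⟩, by simp⟩
  have hbd : BddAbove A := ⟨b, fun x hx => hx.1.2.2⟩
  have hcA : sSup A ∈ A := hAc.csSup_mem ⟨a, haA⟩ hbd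
  set c := sSup A
  have hmax : ∀ x ∈ A, x ≤ c := fun x hx => le_csSup hbd hx
  obtain ⟨⟨hcT, hac, hcb⟩, hc⟩ := hcA
  rcases hcb.eq_or_lt with h | hcb
  · rwa [← h]
  exfalso
  have hstep : ∀ x ∈ T, c < x → x ≤ b → ¬ ‖f x - f c‖ ≤ D * (x - c) := by
    intro x hx hcx hxb hle
    refine not_lt.2 (hmax x ⟨⟨hx, hac.trans hcx.le, hxb⟩, ?_⟩) hcx
    calc ‖f x - f a‖ ≤ ‖f x - f c‖ + ‖f c - f a‖ := norm_sub_le_norm_sub_add_norm_sub _ _ _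
      _ ≤ D * (x - c) + D * (c - a) := add_le_add hle hc
      _ = D * (x - a) := by ring
  have hd := hf c hcT hac hcb
  have hgc := hC c hcT hac hcb
  by_cases hσ : sigma T c = c
  · have h1 := (hasDerivWithinAt_iff_tendsto_slope.1
      (hd.hasDerivWithinAt hσ)).norm.eventually_lt_const (hgc.trans_lt hD)
    rw [eventually_nhdsWithin_iff] at h1
    obtain ⟨ε, hε, h1⟩ := Metric.eventually_nhds_iff.1 h1
    obtain ⟨x, hx, hcx, hx1⟩ := exists_mem_Ioo_of_sigma_eq hσ hb hcb
      (show c < min b (c + ε) from lt_min hcb (by linarith))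
    have hxb := hx1.trans_le (min_le_left _ _)
    have hxε := hx1.trans_le (min_le_right _ _)
    refine hstep x hx hcx hxb.le ?_
    have h2 := h1 (y := x) (by rw [Real.dist_eq, abs_of_pos (sub_pos.2 hcx)]; linarith)
      ⟨hx, hcx.ne'⟩
    have hpos : 0 < x - c := sub_pos.2 hcx
    rw [slope_def_module, norm_smul, norm_inv, Real.norm_of_nonneg hpos.le,
      inv_mul_lt_iff₀ hpos] at h2
    linarith
  · have hlt : c < sigma T c := lt_of_le_of_ne (le_sigma T c) (Ne.symm hσ)
    refine hstep _ (sigma_mem hT hcT) hlt (sigma_le hb hcb) ?_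
    rw [hd.sigma_eq hcT, add_sub_cancel_left, norm_smul, mu,
      Real.norm_of_nonneg (sub_nonneg.2 hlt.le), mul_comm]
    exact mul_le_mul_of_nonneg_right (hgc.trans hD.le) (sub_nonneg.2 hlt.le)

/-- A continuous function whose delta derivative vanishes at every point of `T` other than a
maximum is constant on `T`. -/
theorem eq_of_deltaDeriv_eq_zero (hT : IsClosed T) (hfc : ContinuousOn f T)
    (hf : ∀ t ∈ T, (∃ s ∈ T, t < s) → HasDeltaDerivAt T f 0 t) (ht : t ∈ T) (hs : s ∈ T) :
    f t = f s := by
  wlog h : s ≤ t generalizing s t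
  · exact (this hs ht (le_of_not_ge h)).symm
  have := norm_sub_le_of_norm_deltaDeriv_le hT (g := fun _ => 0) (C := 0) hfc hs ht h
    (fun x hx _ hxt => hf x hx ⟨t, ht, hxt⟩) (fun _ _ _ _ => by simp)
  rw [zero_mul] at this
  exact sub_eq_zero.1 (norm_le_zero_iff.1 this)

/-! ### Restriction of delta derivatives to the truncated time scale -/

/-- At the maximum `t` of `kappa T`, the delta derivative on `kappa T` is a left derivative; by the
mean value inequality it is the left limit of the delta derivatives on `T`. -/
lemma hasDeltaDerivAt_of_tendsto_left (hT : IsClosed T) {g : ℝ → E}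
    (hf : ∀ t ∈ kappa T, HasDeltaDerivAt T f (g t) t) (ht : t ∈ kappa T)
    (hmax : ∀ s ∈ kappa T, s ≤ t) (hg : Tendsto g (𝓝[T ∩ Iio t] t) (𝓝 f')) :
    HasDeltaDerivAt (kappa T) f f' t := by
  have hσ : sigma (kappa T) t = t := sigma_eq_self_of_forall_le hmax
  have htT := kappa_subset T ht
  rw [HasDeltaDerivAt, hσ, Metric.tendsto_nhds]
  intro ε hε
  have h1 := (Metric.tendsto_nhds.1 hg) (ε / 2) (half_pos hε)
  rw [eventually_nhdsWithin_iff] at h1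
  obtain ⟨δ, hδ, h1⟩ := Metric.eventually_nhds_iff.1 h1
  filter_upwards [self_mem_nhdsWithin, mem_nhdsWithin_of_mem_nhds (Ioi_mem_nhds
    (show t - δ < t by linarith))] with s hs hsδ
  have hst : s < t := lt_of_le_of_ne (hmax s hs.1) hs.2
  have hsT := kappa_subset T hs.1
  have hsδ' : t - δ < s := hsδ
  have hid : ∀ x ∈ kappa T, HasDeltaDerivAt T (fun x : ℝ => x • f') f' x := by
    intro x hx
    refine .of_cases (kappa_subset T hx) (fun _ => ?_)
      (fun _ => ContinuousAt.continuousWithinAt (by fun_prop)) (fun _ => ?_)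
    · simpa using (hasDerivWithinAt_id x T).smul_const f'
    · rw [← add_smul, add_mu]
  have h2 := norm_sub_le_of_norm_deltaDeriv_le hT (f := fun x => f x - x • f')
    (g := fun x => g x - f') (C := ε / 2)
    ((continuousOn_of_hasDeltaDerivAt hT hf).sub (continuousOn_of_hasDeltaDerivAt hT hid))
    hsT htT hst.le
    (fun x hx _ hxt => (hf x (mem_kappa_of_lt hx htT hxt)).sub
      (hid x (mem_kappa_of_lt hx htT hxt)))
    (fun x hx hsx hxt => by
      rw [← dist_eq_norm]
      refine (h1 (y := x) ?_ ⟨hx, hxt⟩).le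
      rw [Real.dist_eq, abs_sub_comm, abs_of_pos (sub_pos.2 hxt)]
      linarith)
  have hpos : 0 < t - s := sub_pos.2 hst
  have h3 : (t - s)⁻¹ • (f t - f s) - f' = (t - s)⁻¹ • (f t - t • f' - (f s - s • f')) := by
    have : f t - t • f' - (f s - s • f') = (f t - f s) - (t - s) • f' := by
      rw [sub_smul]; abel
    rw [this, smul_sub _ (f t - f s), inv_smul_smul₀ hpos.ne']
  rw [dist_eq_norm, h3, norm_smul, norm_inv, Real.norm_of_nonneg hpos.le, inv_mul_lt_iff₀ hpos]
  nlinarith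

end Deriv

/-! ### Existence of antiderivatives -/

open Classical in
/-- The last point of `T` that is not to the right of `x`; the minimum of `T` if there is none. -/
noncomputable def lastPoint (T : Set ℝ) (x : ℝ) : ℝ :=
  if (T ∩ Iic x).Nonempty then sSup (T ∩ Iic x) else sInf T

lemma lastPoint_mem (hT : IsTimeScale T) (x : ℝ) : lastPoint T x ∈ T := by
  unfold lastPoint
  split_ifs with h
  · exact ((hT.2.inter isClosed_Iic).csSup_mem h ⟨x, fun s hs => hs.2⟩).1
  · refine hT.2.csInf_mem hT.1 ⟨x, fun s hs => le_of_not_ge fun hsx => h ⟨s, hs, hsx⟩⟩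

lemma le_lastPoint {x : ℝ} (hs : s ∈ T) (hsx : s ≤ x) : s ≤ lastPoint T x := by
  rw [lastPoint, if_pos ⟨s, hs, hsx⟩]
  exact le_csSup ⟨x, fun s hs => hs.2⟩ ⟨hs, hsx⟩

lemma lastPoint_le {x : ℝ} (hs : s ∈ T) (hsx : s ≤ x) : lastPoint T x ≤ x := by
  rw [lastPoint, if_pos ⟨s, hs, hsx⟩]
  exact csSup_le ⟨s, hs, hsx⟩ fun s hs => hs.2

lemma lastPoint_eq_self (ht : t ∈ T) : lastPoint T t = t :=
  le_antisymm (lastPoint_le ht le_rfl) (le_lastPoint ht le_rfl)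

lemma lastPoint_eq_of_lt_sigma (hT : IsTimeScale T) {x : ℝ} (ht : t ∈ T) (htx : t ≤ x)
    (hx : x < sigma T t) : lastPoint T x = t := by
  refine le_antisymm (le_of_not_gt fun h => ?_) (le_lastPoint ht htx)
  exact not_le.2 hx ((sigma_le (lastPoint_mem hT x) h).trans (lastPoint_le ht htx))

section Antideriv

variable {E : Type*} [NormedAddCommGroup E] {f : ℝ → E}

/-- Right-dense continuous functions are bounded on bounded sets: each kind of point has a
neighbourhood on which they are bounded. -/
lemma exists_norm_le_of_rd (hT : IsClosed T)
    (h1 : ∀ t ∈ T, sigma T t = t → ContinuousWithinAt f T t)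
    (h2 : ∀ t ∈ T, rho T t = t → ∃ l, Tendsto f (𝓝[T ∩ Iio t] t) (𝓝 l)) (u v : ℝ) :
    ∃ B, ∀ t ∈ T ∩ Icc u v, ‖f t‖ ≤ B := by
  have hK : IsCompact (T ∩ Icc u v) := isCompact_Icc.inter_left hT
  refine hK.induction_on (p := fun S => ∃ B, ∀ t ∈ S, ‖f t‖ ≤ B) ⟨0, by simp⟩ ?_ ?_ ?_
  · rintro S S' hS ⟨B, hB⟩
    exact ⟨B, fun t ht => hB t (hS ht)⟩
  · rintro S S' ⟨B, hB⟩ ⟨B', hB'⟩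
    exact ⟨max B B', fun t ht => ht.elim (fun h => (hB t h).trans (le_max_left _ _))
      fun h => (hB' t h).trans (le_max_right _ _)⟩
  · intro x hx
    suffices H : ∃ B, ∀ᶠ s in 𝓝[T] x, ‖f s‖ ≤ B by
      obtain ⟨B, hB⟩ := H
      exact ⟨{s | ‖f s‖ ≤ B}, nhdsWithin_mono x inter_subset_left hB, B, fun t ht => ht⟩
    by_cases hσ : sigma T x = x
    · exact ⟨‖f x‖ + 1, (h1 x hx.1 hσ).norm.eventually_le_const (lt_add_one _)⟩
    have hσ' : x < sigma T x := lt_of_le_of_ne (le_sigma T x) (Ne.symm hσ)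
    -- A right-scattered point is not a limit of points of `T` to its right.
    have hright : ∀ᶠ s in 𝓝[T] x, s ≤ x := by
      filter_upwards [self_mem_nhdsWithin, mem_nhdsWithin_of_mem_nhds (Iio_mem_nhds hσ')]
        with s hs hs'
      exact le_of_not_gt fun h => not_le.2 hs' (sigma_le hs h)
    by_cases hρ : rho T x = x
    · obtain ⟨l, hl⟩ := h2 x hx.1 hρ
      have hl' := hl.norm.eventually_le_const (lt_add_one ‖l‖)
      have hl'' : ∀ᶠ s in 𝓝[T] x, s < x → ‖f s‖ ≤ ‖l‖ + 1 := by
        rw [nhdsWithin_inter', eventually_inf_principal] at hl'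
        exact hl'
      refine ⟨max ‖f x‖ (‖l‖ + 1), ?_⟩
      filter_upwards [hright, hl''] with s hs hs'
      rcases hs.eq_or_lt with rfl | h
      · exact le_max_left _ _
      · exact (hs' h).trans (le_max_right _ _)
    · refine ⟨‖f x‖, ?_⟩
      filter_upwards [self_mem_nhdsWithin, hright, mem_nhdsWithin_of_mem_nhds
        (Ioi_mem_nhds (lt_of_le_of_ne (rho_le T x) hρ))] with s hs hs' hs''
      rcases hs'.eq_or_lt with rfl | h
      · exact le_rfl
      · exact absurd (le_rho hs h) (not_le.2 hs'')

lemma aestronglyMeasurable_comp_lastPoint (hT : IsTimeScale T)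
    (h1 : ∀ t ∈ T, sigma T t = t → ContinuousWithinAt f T t) :
    MeasureTheory.AEStronglyMeasurable (fun x => f (lastPoint T x)) MeasureTheory.volume := by
  -- Away from the countable set `D` of one-sidedly isolated points the function is continuous.
  let D : Set ℝ := {x ∈ T | 𝓝[T ∩ Ioi x] x = ⊥} ∪ {x ∈ T | 𝓝[T ∩ Iio x] x = ⊥}
  have hD : D.Countable :=
    countable_setOfPred_isolated_right_within.union countable_setOfPred_isolated_left_within
  have hcont : ∀ x ∈ Dᶜ, ContinuousAt (fun x => f (lastPoint T x)) x := by
    intro x hx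
    by_cases hxT : x ∈ T
    · have hr : (𝓝[T ∩ Ioi x] x).NeBot := ⟨fun h => hx (Or.inl ⟨hxT, h⟩)⟩
      have hl : (𝓝[T ∩ Iio x] x).NeBot := ⟨fun h => hx (Or.inr ⟨hxT, h⟩)⟩
      have hσ : sigma T x = x := by
        by_contra hne
        have hlt : x < sigma T x := lt_of_le_of_ne (le_sigma T x) (Ne.symm hne)
        obtain ⟨s, hs, hs'⟩ := (hr.nonempty_of_mem (inter_mem self_mem_nhdsWithin
          (mem_nhdsWithin_of_mem_nhds (Iio_mem_nhds hlt))))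
        exact not_le.2 hs' (sigma_le hs.1 hs.2)
      have hleft : ∀ b < x, ∃ s ∈ T, b < s ∧ s < x := fun b hb => by
        obtain ⟨s, hs, hs'⟩ := (hl.nonempty_of_mem (inter_mem self_mem_nhdsWithin
          (mem_nhdsWithin_of_mem_nhds (Ioi_mem_nhds hb))))
        exact ⟨s, hs.1, hs', hs.2⟩
      have hπ : Tendsto (lastPoint T) (𝓝 x) (𝓝 x) := by
        rw [tendsto_order]
        refine ⟨fun b hb => ?_, fun b hb => ?_⟩
        · obtain ⟨s, hs, hbs, hsx⟩ := hleft b hb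
          filter_upwards [Ioi_mem_nhds hsx] with y hy
          exact hbs.trans_le (le_lastPoint hs (le_of_lt hy))
        · obtain ⟨s, hs, -, hsx⟩ := hleft (x - 1) (sub_one_lt x)
          filter_upwards [Ioi_mem_nhds hsx, Iio_mem_nhds hb] with y hy hyb
          exact (lastPoint_le hs (le_of_lt hy)).trans_lt hyb
      have hf := h1 x hxT hσ
      rw [ContinuousAt, lastPoint_eq_self hxT]
      exact hf.tendsto.comp (tendsto_nhdsWithin_iff.2 ⟨hπ, .of_forall (lastPoint_mem hT)⟩)
    · obtain ⟨δ, hδ, hball⟩ := Metric.isOpen_iff.1 hT.2.isOpen_compl x hxT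
      refine continuousAt_const.congr (f := fun _ => f (lastPoint T x)) ?_
      filter_upwards [Metric.ball_mem_nhds x hδ] with y hy
      have : T ∩ Iic y = T ∩ Iic x := by
        rw [Metric.mem_ball, Real.dist_eq, abs_lt] at hy
        ext z
        refine and_congr_right fun hz => ?_
        have hz' : ¬ |z - x| < δ := fun h => hball (by rwa [Metric.mem_ball, Real.dist_eq]) hz
        rw [abs_lt, not_and_or] at hz'
        simp only [mem_Iic]
        constructor <;> intro h <;> rcases hz' with h' | h' <;> linarith
      rw [lastPoint, lastPoint, this]
  have hrestrict : (MeasureTheory.volume : MeasureTheory.Measure ℝ).restrict Dᶜ =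
      MeasureTheory.volume :=
    MeasureTheory.Measure.restrict_eq_self_of_ae_mem (hD.ae_notMem _)
  rw [← hrestrict]
  exact ContinuousOn.aestronglyMeasurable
    (fun x hx => (hcont x hx).continuousWithinAt) hD.measurableSet.compl

lemma intervalIntegrable_comp_lastPoint (hT : IsTimeScale T)
    (h1 : ∀ t ∈ T, sigma T t = t → ContinuousWithinAt f T t)
    (h2 : ∀ t ∈ T, rho T t = t → ∃ l, Tendsto f (𝓝[T ∩ Iio t] t) (𝓝 l)) {u v : ℝ}
    (hu : u ∈ T) (hv : v ∈ T) :
    IntervalIntegrable (fun x => f (lastPoint T x)) MeasureTheory.volume u v := by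
  obtain ⟨B, hB⟩ := exists_norm_le_of_rd hT.2 h1 h2 (min u v) (max u v)
  have hmin : min u v ∈ T := by rcases min_choice u v with h | h <;> rwa [h]
  rw [intervalIntegrable_iff]
  refine MeasureTheory.Measure.integrableOn_of_bounded (M := B) (by simp)
    (aestronglyMeasurable_comp_lastPoint hT h1) ?_
  refine (MeasureTheory.ae_restrict_iff' measurableSet_uIoc).2 (.of_forall fun x hx => ?_)
  exact hB _ ⟨lastPoint_mem hT x, le_lastPoint hmin hx.1.le,
    (lastPoint_le hmin hx.1.le).trans hx.2⟩

variable [NormedSpace ℝ E]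

/-- A function that is continuous at right-dense points and has left limits at left-dense points
has a delta antiderivative: the Lebesgue integral of its extension that is constant across the
gaps of `T`. -/
theorem exists_isDeltaAntideriv_of_rd [CompleteSpace E] (hT : IsTimeScale T)
    (h1 : ∀ t ∈ T, sigma T t = t → ContinuousWithinAt f T t)
    (h2 : ∀ t ∈ T, rho T t = t → ∃ l, Tendsto f (𝓝[T ∩ Iio t] t) (𝓝 l)) :
    ∃ F : ℝ → E, IsDeltaAntideriv T F f := by
  obtain ⟨a, ha⟩ := hT.1
  let F : ℝ → E := fun t => ∫ x in a..t, f (lastPoint T x)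
  have hint := fun {u v : ℝ} (hu : u ∈ T) (hv : v ∈ T) =>
    intervalIntegrable_comp_lastPoint hT h1 h2 hu hv
  have hF : ∀ t ∈ T, ∀ s ∈ T, F s - F t = ∫ x in t..s, f (lastPoint T x) := fun t ht s hs =>
    intervalIntegral.integral_interval_sub_left (hint ha hs) (hint ha ht)
  have hmem : ∀ t ∈ T, ∀ s ∈ T, ∀ x ∈ uIoc t s, lastPoint T x ∈ T ∩ uIcc t s := by
    intro t ht s hs x hx
    have hmin : min t s ∈ T := by rcases min_choice t s with h | h <;> rwa [h]
    exact ⟨lastPoint_mem hT x, le_lastPoint hmin hx.1.le,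
      (lastPoint_le hmin hx.1.le).trans hx.2⟩
  refine ⟨F, fun t ht => ?_⟩
  have htT := kappa_subset T ht
  refine .of_cases htT (fun hσ => ?_) (fun hσ => ?_) (fun hσ => ?_)
  · rw [hasDerivWithinAt_iff_isLittleO, Asymptotics.isLittleO_iff]
    intro c hc
    obtain ⟨δ, hδ, hδ'⟩ := Metric.continuousWithinAt_iff.1 (h1 t htT hσ) c hc
    filter_upwards [self_mem_nhdsWithin, mem_nhdsWithin_of_mem_nhds (Metric.ball_mem_nhds t hδ)]
      with s hs hst
    have h3 : F s - F t - (s - t) • f t = ∫ x in t..s, (f (lastPoint T x) - f t) := by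
      rw [intervalIntegral.integral_sub (hint htT hs) intervalIntegrable_const,
        intervalIntegral.integral_const, hF t htT s hs]
    rw [h3, Real.norm_eq_abs]
    refine intervalIntegral.norm_integral_le_of_norm_le_const fun x hx => ?_
    rw [← dist_eq_norm]
    obtain ⟨hx1, hx2⟩ := hmem t htT s hs x hx
    refine (hδ' hx1 ?_).le
    rw [Metric.mem_ball] at hst
    exact (Real.dist_left_le_of_mem_uIcc hx2 |>.trans_eq' (dist_comm _ _)).trans_lt
      (by rwa [dist_comm])
  · obtain ⟨B, hB⟩ := exists_norm_le_of_rd hT.2 h1 h2 (t - 1) (t + 1)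
    have h3 : Tendsto (fun s => B * |s - t|) (𝓝[T] t) (𝓝 0) := by
      have : Tendsto (fun s => B * |s - t|) (𝓝 t) (𝓝 (B * |t - t|)) :=
        Continuous.tendsto (by fun_prop) t
      rw [sub_self, abs_zero, mul_zero] at this
      exact this.mono_left nhdsWithin_le_nhds
    rw [ContinuousWithinAt, tendsto_iff_norm_sub_tendsto_zero]
    refine squeeze_zero' (.of_forall fun _ => norm_nonneg _) ?_ h3
    filter_upwards [self_mem_nhdsWithin, mem_nhdsWithin_of_mem_nhds
      (Icc_mem_nhds (sub_one_lt t) (lt_add_one t))] with s hs hst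
    rw [hF t htT s hs]
    refine intervalIntegral.norm_integral_le_of_norm_le_const fun x hx => ?_
    obtain ⟨hx1, hx2⟩ := hmem t htT s hs x hx
    exact hB _ ⟨hx1, uIcc_subset_Icc ⟨by linarith, by linarith⟩ hst hx2⟩
  · have hle := le_sigma T t
    have h3 : F (sigma T t) - F t = mu T t • f t := by
      rw [hF t htT _ (sigma_mem hT.2 htT), mu, ← intervalIntegral.integral_const]
      refine intervalIntegral.integral_congr_uIoo fun x hx => ?_
      rw [uIoo_of_le hle] at hx
      simp only [lastPoint_eq_of_lt_sigma hT htT hx.1.le hx.2]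
    rw [← h3]; abel

end Antideriv

theorem RdContinuousOn.exists_isDeltaAntideriv {f : ℝ → ℝ} (hT : IsTimeScale T)
    (hf : RdContinuousOn T f) : ∃ F : ℝ → ℝ, IsDeltaAntideriv T F f :=
  exists_isDeltaAntideriv_of_rd hT hf.1 hf.2

/-! ### The exponential function -/

/-- `z ↦ Log (1 + z) / z`, with its removable singularity at `0` removed. -/
noncomputable def logQuotient : ℂ → ℂ := dslope (fun z => Complex.log (1 + z)) 0

lemma hasDerivAt_log_one_add : HasDerivAt (fun z : ℂ => Complex.log (1 + z)) 1 0 := by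
  simpa using ((hasDerivAt_id (0 : ℂ)).const_add 1).clog (by simp)

lemma continuousAt_logQuotient : ContinuousAt logQuotient 0 :=
  continuousAt_dslope_same.2 hasDerivAt_log_one_add.differentiableAt

lemma logQuotient_zero : logQuotient 0 = 1 := by
  rw [logQuotient, dslope_same, hasDerivAt_log_one_add.deriv]

/-- This form of the integrand shows its continuity where `μ` tends to `0`. -/
lemma cylinder_eq (T : Set ℝ) (f : ℝ → ℝ) (t : ℝ) :
    cylinder T f t = (f t : ℂ) * logQuotient ((mu T t * f t : ℝ) : ℂ) := by
  unfold cylinder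
  split_ifs with h
  · simp [h, logQuotient_zero]
  · by_cases hf : f t = 0
    · simp [hf]
    · have hf' : (f t : ℂ) ≠ 0 := Complex.ofReal_ne_zero.2 hf
      have h' : (mu T t : ℂ) ≠ 0 := Complex.ofReal_ne_zero.2 h
      rw [logQuotient, dslope_of_ne _ (Complex.ofReal_ne_zero.2 (mul_ne_zero h hf)), slope_def_field]
      push_cast
      simp only [add_zero, Complex.log_one, sub_zero]
      field_simp

lemma tendsto_cylinder {f : ℝ → ℝ} {l : Filter ℝ} {c : ℝ} (hf : Tendsto f l (𝓝 c))
    (hmu : Tendsto (mu T) l (𝓝 0)) : Tendsto (cylinder T f) l (𝓝 (c : ℂ)) := by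
  have h1 : Tendsto (fun s => ((mu T s * f s : ℝ) : ℂ)) l (𝓝 0) := by
    have h2 := hmu.mul hf
    rw [zero_mul] at h2
    exact Complex.ofReal_zero ▸ (Complex.continuous_ofReal.tendsto 0).comp h2
  have h3 := ((Complex.continuous_ofReal.tendsto c).comp hf).mul
    (continuousAt_logQuotient.tendsto.comp h1)
  rw [logQuotient_zero, mul_one] at h3
  exact h3.congr fun s => (cylinder_eq T f s).symm

lemma exists_isDeltaAntideriv_cylinder (hT : IsTimeScale T) {f : ℝ → ℝ}
    (hf : RdContinuousOn T f) : ∃ G : ℝ → ℂ, IsDeltaAntideriv T G (cylinder T f) := by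
  refine exists_isDeltaAntideriv_of_rd hT (fun t ht h => ?_) (fun t ht h => ?_)
  · have hmu : mu T t = 0 := sub_eq_zero.2 h
    have h1 := (rdContinuousOn_mu hT.2).1 t ht h
    rw [ContinuousWithinAt, hmu] at h1
    rw [ContinuousWithinAt, cylinder, if_pos hmu]
    exact tendsto_cylinder (hf.1 t ht h) h1
  · obtain ⟨l, hl⟩ := hf.2 t ht h
    refine ⟨l, tendsto_cylinder hl ?_⟩
    rw [← sub_self t]
    exact (tendsto_sigma_left ht).sub (tendsto_id.mono_left nhdsWithin_le_nhds)

lemma HasDeltaDerivAt.re {f : ℝ → ℂ} {f' : ℂ} (hf : HasDeltaDerivAt T f f' t) :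
    HasDeltaDerivAt T (fun s => (f s).re) f'.re t := by
  refine ((Complex.continuous_re.tendsto f').comp hf).congr fun s => ?_
  simp only [Function.comp_apply, Complex.smul_re, Complex.sub_re]

lemma deltaExp_self (T : Set ℝ) (f : ℝ → ℝ) (a : ℝ) : deltaExp T f a a = 1 := by
  unfold deltaExp deltaIntegral
  split_ifs <;> simp

/-- Since `f` is real, the real part taken in `deltaExp` preserves the equation. That this real part
has no zeros is not visible here; it follows from the comparison with the Wronskian. -/
theorem hasDeltaDerivAt_deltaExp (hT : IsTimeScale T) {f : ℝ → ℝ} (hf : RdContinuousOn T f)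
    (hreg : Regressive T f) (a : ℝ) (ht : t ∈ kappa T) :
    HasDeltaDerivAt T (fun s => deltaExp T f s a) (f t * deltaExp T f t a) t := by
  have hex := exists_isDeltaAntideriv_cylinder hT hf
  have hG : IsDeltaAntideriv T hex.choose (cylinder T f) := hex.choose_spec
  unfold deltaExp deltaIntegral
  simp only [dif_pos hex]
  set G := hex.choose
  have htT := kappa_subset T ht
  have hGt := hG t ht
  have h1 : HasDeltaDerivAt T (fun s => Complex.exp (G s - G a))
      ((f t : ℂ) * Complex.exp (G t - G a)) t := by
    refine .of_cases htT (fun h => ?_)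
      (fun _ => ((hGt.continuousWithinAt htT).sub continuousWithinAt_const).cexp) (fun h => ?_)
    · have h2 := ((hGt.hasDerivWithinAt h).sub_const (G a)).cexp
      have hmu : mu T t = 0 := sub_eq_zero.2 h
      rwa [cylinder, if_pos hmu, mul_comm] at h2
    · have hmu : mu T t ≠ 0 := sub_ne_zero.2 h
      have hmu' : (mu T t : ℂ) ≠ 0 := Complex.ofReal_ne_zero.2 hmu
      have hne : (1 + (mu T t : ℂ) * (f t : ℂ)) ≠ 0 := by exact_mod_cast hreg t ht
      have h2 : mu T t • cylinder T f t = Complex.log (1 + (mu T t : ℂ) * (f t : ℂ)) := by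
        rw [cylinder, if_neg hmu, Complex.real_smul, one_div, mul_inv_cancel_left₀ hmu']
      rw [hGt.sigma_eq htT, h2, add_sub_right_comm, Complex.exp_add, Complex.exp_log hne,
        Complex.real_smul]
      ring
  simpa using h1.re

/-! ### Solutions and Wronskians on the truncated time scale -/

/-- A criterion for differentiability on `kappa T` that covers both the points where the forward
jumps of `T` and `kappa T` agree and the maximum of `kappa T`. -/
lemma hasDeltaDerivAt_kappa (hT : IsClosed T) {f g : ℝ → ℝ} {f' : ℝ}
    (hf : ∀ t ∈ kappa T, HasDeltaDerivAt T f (g t) t) (ht : t ∈ kappa T)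
    (h1 : sigma (kappa T) t = sigma T t → f' = g t)
    (h2 : sigma (kappa T) t = t → Tendsto g (𝓝[T ∩ Iio t] t) (𝓝 f')) :
    HasDeltaDerivAt (kappa T) f f' t := by
  rcases sigma_kappa_or T t with h | ⟨h, hmax⟩
  · rw [h1 h]
    exact (hf t ht).mono (kappa_subset T) h
  · exact hasDeltaDerivAt_of_tendsto_left hT hf ht hmax (h2 h)

section Linear

variable {p q r r' y u yΔ uΔ : ℝ → ℝ}

lemma IsSolutionWith.add (hy : IsSolutionWith T p q r y yΔ) (hu : IsSolutionWith T p q r' u uΔ) :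
    IsSolutionWith T p q (fun t => r t + r' t) (fun t => y t + u t) (fun t => yΔ t + uΔ t) := by
  obtain ⟨h1, w, h2, h3⟩ := hy
  obtain ⟨k1, v, k2, k3⟩ := hu
  refine ⟨fun t ht => (h1 t ht).add (k1 t ht), fun t => w t + v t,
    fun t ht => (h2 t ht).add (k2 t ht), fun t ht => ?_⟩
  linear_combination h3 t ht + k3 t ht

lemma IsSolutionWith.const_mul (c : ℝ) (hy : IsSolutionWith T p q r y yΔ) :
    IsSolutionWith T p q (fun t => c * r t) (fun t => c * y t) (fun t => c * yΔ t) := by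
  obtain ⟨h1, w, h2, h3⟩ := hy
  refine ⟨fun t ht => (h1 t ht).const_mul c, fun t => c * w t,
    fun t ht => (h2 t ht).const_mul c, fun t ht => ?_⟩
  linear_combination c * h3 t ht

lemma IsSolutionWith.sub (hy : IsSolutionWith T p q r y yΔ) (hu : IsSolutionWith T p q r' u uΔ) :
    IsSolutionWith T p q (fun t => r t - r' t) (fun t => y t - u t) (fun t => yΔ t - uΔ t) := by
  obtain ⟨h1, w, h2, h3⟩ := hy
  obtain ⟨k1, v, k2, k3⟩ := hu
  refine ⟨fun t ht => (h1 t ht).sub (k1 t ht), fun t => w t - v t,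
    fun t ht => (h2 t ht).sub (k2 t ht), fun t ht => ?_⟩
  linear_combination h3 t ht - k3 t ht

lemma IsSolutionWith.congr (hT : IsClosed T) (hy : IsSolutionWith T p q r y yΔ)
    (hu : EqOn u y T) : IsSolutionWith T p q r u yΔ := by
  obtain ⟨h1, w, h2, h3⟩ := hy
  refine ⟨fun t ht => (h1 t ht).congr_on hT (kappa_subset T ht) hu, w, h2, fun t ht => ?_⟩
  rw [hu (kappa_subset T (kappa_subset _ ht))]
  exact h3 t ht

lemma IsSolutionWith.continuousOn (hT : IsClosed T) (hy : IsSolutionWith T p q r y yΔ) :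
    ContinuousOn y T := continuousOn_of_hasDeltaDerivAt hT hy.1

lemma IsSolutionWith.continuousOn_deriv (hT : IsClosed T) (hy : IsSolutionWith T p q r y yΔ) :
    ContinuousOn yΔ (kappa T) := by
  obtain ⟨-, w, h2, -⟩ := hy
  exact continuousOn_of_hasDeltaDerivAt (isClosed_kappa hT) h2

/-- The derivative of a solution on `T` is also its derivative on `kappa T`, even where the two
forward jumps differ: there the continuity of the derivative is used. -/
lemma IsSolutionWith.hasDeltaDerivAt_kappa (hT : IsClosed T) (hy : IsSolutionWith T p q r y yΔ)
    (ht : t ∈ kappa (kappa T)) : HasDeltaDerivAt (kappa T) y (yΔ t) t :=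
  TimeScale.hasDeltaDerivAt_kappa hT hy.1 (kappa_subset _ ht) (fun _ => rfl) fun _ =>
    (hy.continuousOn_deriv hT t (kappa_subset _ ht)).mono_left
      (nhdsWithin_mono _ (inter_Iio_subset_kappa (kappa_subset T (kappa_subset _ ht))))

/-- Abel's formula in differential form. The graininess in the coefficient is that of
`kappa T`. -/
lemma hasDeltaDerivAt_wronskian (hT : IsClosed T)
    (hy : IsSolutionWith T p q (fun _ => 0) y yΔ) (hu : IsSolutionWith T p q (fun _ => 0) u uΔ)
    (ht : t ∈ kappa (kappa T)) :
    HasDeltaDerivAt (kappa T) (fun s => y s * uΔ s - u s * yΔ s)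
      (coeff (kappa T) p q t * (y t * uΔ t - u t * yΔ t)) t := by
  have htK := kappa_subset _ ht
  have hy1 := hy.hasDeltaDerivAt_kappa hT ht
  have hu1 := hu.hasDeltaDerivAt_kappa hT ht
  obtain ⟨-, w, h2, h3⟩ := hy
  obtain ⟨-, v, k2, k3⟩ := hu
  have h := (hy1.mul htK (k2 t ht)).sub (hu1.mul htK (h2 t ht))
  rw [hy1.sigma_eq htK, hu1.sigma_eq htK, smul_eq_mul, smul_eq_mul] at h
  convert h using 1
  have e1 := h3 t ht
  have e2 := k3 t ht
  simp only at e1 e2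
  rw [coeff]
  linear_combination (u t + mu (kappa T) t * uΔ t) * e1 - (y t + mu (kappa T) t * yΔ t) * e2

lemma continuousOn_wronskian (hT : IsClosed T)
    (hy : IsSolutionWith T p q r y yΔ) (hu : IsSolutionWith T p q r' u uΔ) :
    ContinuousOn (fun s => y s * uΔ s - u s * yΔ s) (kappa T) :=
  (((hy.continuousOn hT).mono (kappa_subset T)).mul (hu.continuousOn_deriv hT)).sub
    (((hu.continuousOn hT).mono (kappa_subset T)).mul (hy.continuousOn_deriv hT))

end Linear

/-- Two solutions of the same first order linear equation are proportional if one of them has no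
zeros. The equation is not needed at a maximum of `T`. -/
lemma exists_eq_const_mul (hT : IsTimeScale T) {f g c : ℝ → ℝ} (hfc : ContinuousOn f T)
    (hgc : ContinuousOn g T) (hg0 : ∀ t ∈ T, g t ≠ 0)
    (hf : ∀ t ∈ T, (∃ s ∈ T, t < s) → HasDeltaDerivAt T f (c t * f t) t)
    (hg : ∀ t ∈ T, (∃ s ∈ T, t < s) → HasDeltaDerivAt T g (c t * g t) t) :
    ∃ k, ∀ t ∈ T, f t = k * g t := by
  obtain ⟨a, ha⟩ := hT.1
  refine ⟨f a / g a, fun t ht => ?_⟩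
  have h : f t / g t = f a / g a := by
    refine eq_of_deltaDeriv_eq_zero (f := fun t => f t / g t) hT.2 (hfc.div hgc hg0)
      (fun x hx hs => ?_) ht ha
    convert (hf x hx hs).div hx (hg x hx hs) (hg0 x hx) (hg0 _ (sigma_mem hT.2 hx)) using 1
    rw [mul_right_comm, mul_assoc, mul_left_comm (f x), mul_comm (f x), sub_self, zero_div]
  rw [← h, div_mul_cancel₀ _ (hg0 t ht)]

variable {p q : ℝ → ℝ}

/-- Solutions with nonvanishing Wronskian span the solutions of the homogeneous equation: the
coefficients are the (constant) quotients of Wronskians in Cramer's rule. -/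
theorem exists_eq_linear_combination (hT : IsTimeScale T) {y₁ y₂ u y₁Δ y₂Δ uΔ : ℝ → ℝ}
    (h₁ : IsSolutionWith T p q (fun _ => 0) y₁ y₁Δ) (h₂ : IsSolutionWith T p q (fun _ => 0) y₂ y₂Δ)
    (hW : ∀ t ∈ kappa T, y₁ t * y₂Δ t - y₂ t * y₁Δ t ≠ 0)
    (hu : IsSolutionWith T p q (fun _ => 0) u uΔ) :
    ∃ c₁ c₂ : ℝ, ∀ t ∈ T, u t = c₁ * y₁ t + c₂ * y₂ t := by
  have hK := isTimeScale_kappa hT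
  have hnm : ∀ t ∈ kappa T, (∃ s ∈ kappa T, t < s) → t ∈ kappa (kappa T) :=
    fun t ht ⟨s, hs, hts⟩ => mem_kappa_of_lt ht hs hts
  have hprop : ∀ {v w vΔ wΔ : ℝ → ℝ}, IsSolutionWith T p q (fun _ => 0) v vΔ →
      IsSolutionWith T p q (fun _ => 0) w wΔ → ∃ k, ∀ t ∈ kappa T,
        v t * wΔ t - w t * vΔ t = k * (y₁ t * y₂Δ t - y₂ t * y₁Δ t) := fun hv hw =>
    exists_eq_const_mul hK (continuousOn_wronskian hT.2 hv hw) (continuousOn_wronskian hT.2 h₁ h₂)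
      hW (fun t ht h => hasDeltaDerivAt_wronskian hT.2 hv hw (hnm t ht h))
      (fun t ht h => hasDeltaDerivAt_wronskian hT.2 h₁ h₂ (hnm t ht h))
  obtain ⟨c₁, hc₁⟩ := hprop hu h₂
  obtain ⟨c₂, hc₂⟩ := hprop h₁ hu
  have e1 : ∀ t ∈ kappa T, u t = c₁ * y₁ t + c₂ * y₂ t := fun t ht =>
    mul_right_cancel₀ (hW t ht) (by linear_combination y₁ t * hc₁ t ht + y₂ t * hc₂ t ht)
  have e2 : ∀ t ∈ kappa T, uΔ t = c₁ * y₁Δ t + c₂ * y₂Δ t := fun t ht =>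
    mul_right_cancel₀ (hW t ht) (by linear_combination y₁Δ t * hc₁ t ht + y₂Δ t * hc₂ t ht)
  refine ⟨c₁, c₂, fun t ht => ?_⟩
  by_cases htK : t ∈ kappa T
  · exact e1 t htK
  · obtain ⟨m, hm, -, rfl⟩ := exists_sigma_eq_of_notMem_kappa hT.2 ht htK
    have hmT := kappa_subset T hm
    rw [(hu.1 m hm).sigma_eq hmT, (h₁.1 m hm).sigma_eq hmT, (h₂.1 m hm).sigma_eq hmT, e1 m hm,
      e2 m hm]
    simp only [smul_eq_mul]
    ring

/-! ### Reduction of order -/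

/-- Abel's formula: the Wronskian is a nonzero multiple of the exponential function. -/
theorem exists_deltaExp_eq_mul_wronskian (hT : IsTimeScale T) {a : ℝ} (ha : a ∈ T)
    (hp : RdContinuousOn T p) (hq : RdContinuousOn T q) (hreg : Regressive T (coeff T p q))
    {y₁ y₂ y₁Δ y₂Δ : ℝ → ℝ}
    (h₁ : IsSolutionWith T p q (fun _ => 0) y₁ y₁Δ) (h₂ : IsSolutionWith T p q (fun _ => 0) y₂ y₂Δ)
    (hW : ∀ t ∈ kappa T, y₁ t * y₂Δ t - y₂ t * y₁Δ t ≠ 0) :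
    ∃ k ≠ 0, ∀ t ∈ kappa T,
      deltaExp T (coeff T p q) t a = k * (y₁ t * y₂Δ t - y₂ t * y₁Δ t) := by
  have hE := fun t ht => hasDeltaDerivAt_deltaExp (t := t) hT (rdContinuousOn_coeff hT.2 hp hq)
    hreg a ht
  obtain ⟨k, hk⟩ := exists_eq_const_mul (f := fun t => deltaExp T (coeff T p q) t a)
    (c := coeff T p q) (isTimeScale_kappa hT)
    ((continuousOn_of_hasDeltaDerivAt hT.2 hE).mono (kappa_subset T))
    (continuousOn_wronskian hT.2 h₁ h₂) hW
    (fun t ht ⟨s, hs, hts⟩ => (hE t ht).mono (kappa_subset T) (sigma_kappa_of_lt hs hts))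
    (fun t ht ⟨s, hs, hts⟩ => by
      have := hasDeltaDerivAt_wronskian hT.2 h₁ h₂ (mem_kappa_of_lt ht hs hts)
      rwa [coeff, mu, sigma_kappa_of_lt hs hts] at this)
  refine ⟨k, ?_, hk⟩
  -- The exponential function is `1` at `a`, which may be the point of `T` outside `kappa T`.
  rintro rfl
  have h1 := deltaExp_self T (coeff T p q) a
  by_cases haK : a ∈ kappa T
  · rw [hk a haK, zero_mul] at h1
    exact zero_ne_one h1
  · obtain ⟨m, hm, -, hσ⟩ := exists_sigma_eq_of_notMem_kappa hT.2 ha haK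
    have h2 := (hE m hm).sigma_eq (kappa_subset T hm)
    rw [hk m hm, hσ, h1] at h2
    simp at h2

/-- On `kappa T` this is Abel's formula; a further point of `T` is reached by one jump, where
regressivity is used. -/
theorem deltaExp_ne_zero (hT : IsTimeScale T) {a : ℝ} (ha : a ∈ T)
    (hp : RdContinuousOn T p) (hq : RdContinuousOn T q) (hreg : Regressive T (coeff T p q))
    {y₁ y₂ y₁Δ y₂Δ : ℝ → ℝ}
    (h₁ : IsSolutionWith T p q (fun _ => 0) y₁ y₁Δ) (h₂ : IsSolutionWith T p q (fun _ => 0) y₂ y₂Δ)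
    (hW : ∀ t ∈ kappa T, y₁ t * y₂Δ t - y₂ t * y₁Δ t ≠ 0) (ht : t ∈ T) :
    deltaExp T (coeff T p q) t a ≠ 0 := by
  obtain ⟨k, hk0, hk⟩ := exists_deltaExp_eq_mul_wronskian hT ha hp hq hreg h₁ h₂ hW
  have hK : ∀ t ∈ kappa T, deltaExp T (coeff T p q) t a ≠ 0 := fun t ht => by
    rw [hk t ht]
    exact mul_ne_zero hk0 (hW t ht)
  by_cases htK : t ∈ kappa T
  · exact hK t htK
  · obtain ⟨m, hm, -, rfl⟩ := exists_sigma_eq_of_notMem_kappa hT.2 ht htK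
    rw [(hasDeltaDerivAt_deltaExp hT (rdContinuousOn_coeff hT.2 hp hq) hreg a hm).sigma_eq
      (kappa_subset T hm), smul_eq_mul, ← mul_assoc, ← one_add_mul]
    exact mul_ne_zero (hreg m hm) (hK m hm)

/-- Being a multiple of the Wronskian, the exponential function inherits its equation on
`kappa T`. -/
theorem hasDeltaDerivAt_deltaExp_kappa (hT : IsTimeScale T) {a : ℝ} (ha : a ∈ T)
    (hp : RdContinuousOn T p) (hq : RdContinuousOn T q) (hreg : Regressive T (coeff T p q))
    {y₁ y₂ y₁Δ y₂Δ : ℝ → ℝ}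
    (h₁ : IsSolutionWith T p q (fun _ => 0) y₁ y₁Δ) (h₂ : IsSolutionWith T p q (fun _ => 0) y₂ y₂Δ)
    (hW : ∀ t ∈ kappa T, y₁ t * y₂Δ t - y₂ t * y₁Δ t ≠ 0) (ht : t ∈ kappa (kappa T)) :
    HasDeltaDerivAt (kappa T) (fun s => deltaExp T (coeff T p q) s a)
      (coeff (kappa T) p q t * deltaExp T (coeff T p q) t a) t := by
  obtain ⟨k, -, hk⟩ := exists_deltaExp_eq_mul_wronskian hT ha hp hq hreg h₁ h₂ hW
  have h := ((hasDeltaDerivAt_wronskian hT.2 h₁ h₂ ht).const_mul k).congr_on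
    (isClosed_kappa hT.2) (kappa_subset _ ht) hk
  rwa [mul_left_comm, ← hk t (kappa_subset _ ht)] at h

section Particular

variable {r z zΔ F V E : ℝ → ℝ}

lemma exists_isIteratedIntegral (hT : IsTimeScale T) {a : ℝ} (hr : RdContinuousOn T r)
    (hzc : ContinuousOn z T) (hz0 : ∀ t ∈ T, z t ≠ 0)
    (hEc : ContinuousOn (fun t => deltaExp T (coeff T p q) t a) T)
    (hE0 : ∀ t ∈ T, deltaExp T (coeff T p q) t a ≠ 0) :
    ∃ V, IsIteratedIntegral T p q r z a V := by
  have hinner : RdContinuousOn T (innerIntegrand T p q r z a) :=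
    (hr.mul (.comp_sigma hT.2 hzc)).mul (.comp_sigma hT.2 (continuousOn_const.div hEc hE0))
  obtain ⟨F, hF⟩ := hinner.exists_isDeltaAntideriv hT
  have houter : RdContinuousOn T (outerIntegrand T p q z F a) := by
    have h := (RdContinuousOn.of_continuousOn ((hEc.mul
      (continuousOn_of_hasDeltaDerivAt hT.2 hF)).div hzc hz0)).mul
      (.comp_sigma hT.2 (hzc.inv₀ hz0))
    convert h using 2 with t
    rw [outerIntegrand, ← div_div, div_eq_mul_inv (_ / _)]
    rfl
  obtain ⟨V, hV⟩ := houter.exists_isDeltaAntideriv hT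
  exact ⟨V, F, hF, hV⟩

/-- The substitution `y = z V` of reduction of order: `E F` is the Wronskian of `z` and `z V`. -/
theorem isSolutionWith_mul_of_isDeltaAntideriv (hT : IsTimeScale T)
    (hrK : RdContinuousOn (kappa T) r) (hz : IsSolutionWith T p q (fun _ => 0) z zΔ)
    (hz0 : ∀ t ∈ T, z t ≠ 0) (hEc : ContinuousOn E T) (hE0 : ∀ t ∈ T, E t ≠ 0)
    (hE : ∀ t ∈ kappa (kappa T), HasDeltaDerivAt (kappa T) E (coeff (kappa T) p q t * E t) t)
    (hF : IsDeltaAntideriv T F fun t => r t * z (sigma T t) * (1 / E (sigma T t)))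
    (hV : IsDeltaAntideriv T V fun t => E t * F t / (z t * z (sigma T t))) :
    IsSolutionWith T p q r (fun t => z t * V t) (fun t => zΔ t * V t + E t * F t / z t) := by
  have hzc := hz.continuousOn hT.2
  have hFc := continuousOn_of_hasDeltaDerivAt hT.2 hF
  refine ⟨fun t ht => ?_, ?_⟩
  · have htT := kappa_subset T ht
    have h1 := hz0 t htT
    have h2 := hz0 _ (sigma_mem hT.2 htT)
    convert (hz.1 t ht).mul htT (hV t ht) using 1
    field_simp
  have hK := isClosed_kappa hT.2
  -- On `kappa T`, the derivatives of `F` and `V` are given by the same formulas with the forward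
  -- jump of `kappa T`; where the two jumps differ these are the left limits of the integrands.
  have hFK : ∀ t ∈ kappa (kappa T), HasDeltaDerivAt (kappa T) F
      (r t * z (sigma (kappa T) t) * (1 / E (sigma (kappa T) t))) t := by
    intro t ht
    have htK := kappa_subset _ ht
    have htT := kappa_subset T htK
    refine hasDeltaDerivAt_kappa hT.2 hF htK (fun h => by rw [h]) fun h => ?_
    rw [h]
    exact (((hrK.1 t htK h).mono_left (nhdsWithin_mono _ (inter_Iio_subset_kappa htT))).mul
      (tendsto_comp_sigma_left hT.2 hzc htT)).mul
      (tendsto_comp_sigma_left hT.2 (continuousOn_const.div hEc hE0) htT)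
  have hVK : ∀ t ∈ kappa (kappa T), HasDeltaDerivAt (kappa T) V
      (E t * F t / (z t * z (sigma (kappa T) t))) t := by
    intro t ht
    have htK := kappa_subset _ ht
    have htT := kappa_subset T htK
    have hleft : ∀ {g : ℝ → ℝ}, ContinuousOn g T → Tendsto g (𝓝[T ∩ Iio t] t) (𝓝 (g t)) :=
      fun hg => (hg t htT).mono_left (nhdsWithin_mono _ inter_subset_left)
    refine hasDeltaDerivAt_kappa hT.2 hV htK (fun h => by rw [h]) fun h => ?_
    rw [h]
    exact ((hleft hEc).mul (hleft hFc)).div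
      ((hleft hzc).mul (tendsto_comp_sigma_left hT.2 hzc htT))
      (mul_ne_zero (hz0 t htT) (hz0 t htT))
  have hzK := fun t ht => hz.hasDeltaDerivAt_kappa (t := t) hT.2 ht
  obtain ⟨-, w, hw, hw'⟩ := hz
  refine ⟨_, fun t ht => ((hw t ht).mul (kappa_subset _ ht) (hVK t ht)).add
    (((hE t ht).mul (kappa_subset _ ht) (hFK t ht)).div (kappa_subset _ ht) (hzK t ht)
      (hz0 t (kappa_subset T (kappa_subset _ ht)))
      (hz0 _ (kappa_subset T (sigma_mem hK (kappa_subset _ ht))))), fun t ht => ?_⟩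
  have htK := kappa_subset _ ht
  have h1 := hz0 t (kappa_subset T htK)
  have h2 := hz0 _ (kappa_subset T (sigma_mem hK htK))
  have h3 := hE0 _ (kappa_subset T (sigma_mem hK htK))
  have e1 := hw' t ht
  have e2 := (hw t ht).sigma_eq htK
  have e3 := (hzK t ht).sigma_eq htK
  simp only [smul_eq_mul] at e1 e2 e3
  rw [e2, coeff]
  field_simp
  linear_combination (V t * z t * z (sigma (kappa T) t) + mu (kappa T) t * E t * F t) * e1 +
    p t * E t * F t * e3

end Particular

end TimeScale

theorem theorem3p1 (T : Set ℝ) (hT : TimeScale.IsTimeScale T) (a : ℝ) (ha : a ∈ T)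
    (p q r : ℝ → ℝ)
    (hp : TimeScale.RdContinuousOn T p)
    (hq : TimeScale.RdContinuousOn T q)
    (hr : TimeScale.RdContinuousOn T r)
    (hr_kappa : TimeScale.RdContinuousOn (TimeScale.kappa T) r)
    (hreg : TimeScale.Regressive T (TimeScale.coeff T p q))
    (y yΔ : Fin 2 → ℝ → ℝ)
    (hy : ∀ i, TimeScale.IsSolutionWith T p q (fun _ => 0) (y i) (yΔ i))
    (hW : ∀ t ∈ TimeScale.kappa T, y 0 t * yΔ 1 t - y 1 t * yΔ 0 t ≠ 0)
    (i : Fin 2) (hi : ∀ t ∈ T, y i t ≠ 0) :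
    (∃ V : ℝ → ℝ, TimeScale.IsIteratedIntegral T p q r (y i) a V) ∧
    ∀ V : ℝ → ℝ, TimeScale.IsIteratedIntegral T p q r (y i) a V →
      ∀ x : ℝ → ℝ, TimeScale.IsSolution T p q r x ↔
        ∃ c₁ c₂ : ℝ, ∀ t ∈ T, x t = c₁ * y 0 t + c₂ * y 1 t + y i t * V t := by
  open TimeScale in
  have hEc : ContinuousOn (fun t => deltaExp T (coeff T p q) t a) T :=
    continuousOn_of_hasDeltaDerivAt hT.2 fun t ht =>
      hasDeltaDerivAt_deltaExp hT (rdContinuousOn_coeff hT.2 hp hq) hreg a ht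
  have hE0 : ∀ t ∈ T, deltaExp T (coeff T p q) t a ≠ 0 := fun t ht =>
    deltaExp_ne_zero hT ha hp hq hreg (hy 0) (hy 1) hW ht
  refine ⟨exists_isIteratedIntegral hT hr ((hy i).continuousOn hT.2) hi hEc hE0, ?_⟩
  rintro V ⟨F, hF, hV⟩ x
  have hpart := isSolutionWith_mul_of_isDeltaAntideriv hT hr_kappa (hy i) hi hEc hE0
    (fun t ht => hasDeltaDerivAt_deltaExp_kappa hT ha hp hq hreg (hy 0) (hy 1) hW ht) hF hV
  constructor
  · rintro ⟨xΔ, hx⟩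
    have hu := hx.sub hpart
    simp only [sub_self] at hu
    obtain ⟨c₁, c₂, hc⟩ := exists_eq_linear_combination hT (hy 0) (hy 1) hW hu
    exact ⟨c₁, c₂, fun t ht => by linear_combination hc t ht⟩
  · rintro ⟨c₁, c₂, hc⟩
    have h := ((hy 0).const_mul c₁).add ((hy 1).const_mul c₂) |>.add hpart
    simp only [mul_zero, zero_add] at h
    exact ⟨_, h.congr hT.2 hc⟩
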